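/- Setting. Let $\mathcal K\subset\mathbb R^d$ (arms, non-empty, spanning $\mathbb R^d$) and $\mathcal Z\subset\mathbb R^d$ (answers, non-empty) be finite, $\mathcal M\subseteq\mathbb R^d$ a set of possible parameters, and $\varepsilon\ge 0$. In round $t\ge1$ a strategy pulls an arm $a_t\in\mathcal K$ chosen from the past (and possibly internal randomization) and observes $X_t=\langle\mu,a_t\rangle+\eta_t$, where $\eta_t\sim\mathcal N(0,1)$ is independent of the past and $\mu\in\mathcal M$ is unknown. For each $\delta\in(0,1)$ it has a stopping time $\tau_\delta$ with respect to the history $(\mathcal F_t)$ and an $\mathcal F_{\tau_\delta}$-measurable recommendation $\hat z\in\mathcal Z$; all its rules may depend on $\delta$. Let $$z^\star(\mu)=\operatorname*{argmax}_{z\in\mathcal Z}\langle\mu,z\rangle ,$$ and let $\mathcal Z_\varepsilon(\mu)$ be either the additive set $\{z\in\mathcal Z:\langle\mu,z\rangle\ge\max_{z'\in\mathcal Z}\langle\mu,z'\rangle-\varepsilon\}$ or the multiplicative set $\{z\in\mathcal Z:\langle\mu,z\rangle\ge(1-\varepsilon)\max_{z'\in\mathcal Z}\langle\mu,z'\rangle\}$,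 where in the multiplicative case it is assumed that $\max_{z\in\mathcal Z}\langle\mu,z\rangle>0$ for all $\mu\in\mathcal M$. A strategy is $(\varepsilon,\delta)$-PAC if, for every $\delta\in(0,1)$ and $\mu\in\mathcal M$, $\mathbb P_\mu[\tau_\delta<\infty,\ \hat z\notin\mathcal Z_\varepsilon(\mu)]\le\delta$, and it is asymptotically greedy if, for every $\mu\in\mathcal M$, $\lim_{\delta\to0}\mathbb P_\mu[\tau_\delta<\infty,\ \hat z\in\mathcal Z_\varepsilon(\mu)\setminus z^\star(\mu)]=0$. Write $\neg_\varepsilon z=\overline{\{\lambda\in\mathcal M: z\notin\mathcal Z_\varepsilon(\lambda)\}}$, $V_w=\sum_{a\in\mathcal K}w^a\,aa^{\mathsf T}$, $\|x\|_V=\sqrt{x^{\mathsf T}Vx}$, let $\triangle_K$ be the probability simplex over $\mathcal K$, and set $$T_\varepsilon(\mu)^{-1}=\max_{z\in\mathcal Z_\varepsilon(\mu)}\max_{w\in\triangle_K}\inf_{\lambda\in\neg_\varepsilon z}\tfrac12\|\mu-\lambda\|_{V_w}^2,\qquad T_{g,\varepsilon}(\mu)^{-1}=\max_{z\in z^\star(\mu)}\max_{w\in\triangle_K}\inf_{\lambda\in\neg_\varepsilon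 z}\tfrac12\|\mu-\lambda\|_{V_w}^2$$ in $[0,\infty]$, with $\inf\emptyset=\infty$, $1/\infty=0$ and $1/0=\infty$. Statement. (i) For every asymptotically greedy $(\varepsilon,\delta)$-PAC strategy and every $\mu\in\mathcal M$, $$\liminf_{\delta\to0}\frac{\mathbb E_\mu[\tau_\delta]}{\ln(1/\delta)}\ \ge\ T_{g,\varepsilon}(\mu).$$ (ii) Let $\mu\in\mathcal M$ have a unique furthest answer $z_F(\mu)$, i.e. $z_F(\mu)$ is the only $z\in\mathcal Z_\varepsilon(\mu)$ for which some $(z,w)$ maximises $(z,w)\mapsto\inf_{\lambda\in\neg_\varepsilon z}\frac12\|\mu-\lambda\|_{V_w}^2$ over $\mathcal Z_\varepsilon(\mu)\times\triangle_K$. Then $T_{g,\varepsilon}(\mu)>T_\varepsilon(\mu)$ if and only if $z_F(\mu)\notin z^\star(\mu)$. (iii) Consequently, for such $\mu$ with $z_F(\mu)\notin z^\star(\mu)$, every asymptotically greedy $(\varepsilon,\delta)$-PAC strategy is asymptotically sub-optimal at $\mu$: $\liminf_{\delta\to0}\mathbb E_\mu[\tau_\delta]/\ln(1/\delta)>T_\varepsilon(\mu)$.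 -/

import Mathlib

open MeasureTheory ProbabilityTheory Filter Topology
open scoped ENNReal

noncomputable section

namespace EpsBAI

/-- The ambient space `ℝ^d` with its Euclidean structure. -/
abbrev Vec (d : ℕ) : Type := EuclideanSpace ℝ (Fin d)

/-- A transductive linear bandit problem: finitely many arms spanning `ℝ^d`, finitely many answers,
and a set of possible mean parameters. -/
structure Problem (d : ℕ) where
  arms : Finset (Vec d)
  answers : Finset (Vec d)
  params : Set (Vec d)
  arms_nonempty : arms.Nonempty
  answers_nonempty : answers.Nonempty
  span_arms : Submodule.span ℝ (arms : Set (Vec d)) = ⊤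

/-- The two notions of `ε`-optimality. -/
inductive Optimality where
  | additive
  | multiplicative

namespace Problem

variable {d : ℕ} (B : Problem d)

/-- `max_{z ∈ Z} ⟨μ, z⟩`. -/
def maxValue (μ : Vec d) : ℝ :=
  B.answers.sup' B.answers_nonempty (fun z => inner ℝ μ z)

/-- The greedy answers `z⋆(μ) = argmax_{z ∈ Z} ⟨μ, z⟩`. -/
def greedyAnswers (μ : Vec d) : Set (Vec d) :=
  {z | z ∈ B.answers ∧ ∀ z' ∈ B.answers, inner ℝ μ z' ≤ inner ℝ μ z}

/-- The set `Z_ε(μ)` of `ε`-optimal answers. -/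
def epsOptimal (ε : ℝ) (μ : Vec d) : Optimality → Set (Vec d)
  | .additive => {z | z ∈ B.answers ∧ B.maxValue μ - ε ≤ inner ℝ μ z}
  | .multiplicative => {z | z ∈ B.answers ∧ (1 - ε) * B.maxValue μ ≤ inner ℝ μ z}

/-- The standing requirement of the multiplicative notion: `max_{z ∈ Z} ⟨μ, z⟩ > 0` for all possible
parameters. Nothing is required for the additive notion. -/
def Admissible : Optimality → Prop
  | .additive => True
  | .multiplicative => ∀ μ ∈ B.params, 0 < B.maxValue μ

/-- The alternative `¬_ε z`: the closure of the set of parameters for which `z` is not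
`ε`-optimal. -/
def alternative (ε : ℝ) (o : Optimality) (z : Vec d) : Set (Vec d) :=
  closure {l | l ∈ B.params ∧ z ∉ B.epsOptimal ε l o}

/-- The design matrix `V_w = ∑_a w^a a aᵀ`. -/
def designMatrix (w : B.arms → ℝ) : Matrix (Fin d) (Fin d) ℝ :=
  ∑ a : B.arms, w a • Matrix.vecMulVec (a : Vec d).ofLp (a : Vec d).ofLp

/-- The seminorm `‖x‖_V = √(xᵀ V x)` of a positive semi-definite matrix `V`. -/
def seminormOf (V : Matrix (Fin d) (Fin d) ℝ) (x : Vec d) : ℝ :=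
  Real.sqrt (x.ofLp ⬝ᵥ V.mulVec x.ofLp)

/-- The game value `inf_{λ ∈ ¬_ε z} ½ ‖μ - λ‖²_{V_w}`, as an element of `[0, ∞]`
(it is `∞` when the alternative is empty). -/
def gameValue (ε : ℝ) (o : Optimality) (μ z : Vec d) (w : B.arms → ℝ) : ℝ≥0∞ :=
  ⨅ l ∈ B.alternative ε o z,
    ENNReal.ofReal (1 / 2 * seminormOf (B.designMatrix w) (μ - l) ^ 2)

/-- The characteristic time `T_ε(μ)`, the inverse of
`max_{z ∈ Z_ε(μ)} max_{w ∈ △} inf_{λ ∈ ¬_ε z} ½ ‖μ - λ‖²_{V_w}`. -/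
def charTime (ε : ℝ) (o : Optimality) (μ : Vec d) : ℝ≥0∞ :=
  (⨆ z ∈ B.epsOptimal ε μ o, ⨆ w ∈ stdSimplex ℝ B.arms, B.gameValue ε o μ z w)⁻¹

/-- The greedy characteristic time `T_{g,ε}(μ)`: the maximum is only over the greedy answers. -/
def greedyCharTime (ε : ℝ) (o : Optimality) (μ : Vec d) : ℝ≥0∞ :=
  (⨆ z ∈ B.greedyAnswers μ, ⨆ w ∈ stdSimplex ℝ B.arms, B.gameValue ε o μ z w)⁻¹

/-- The furthest answers: the answers `z` occurring in some maximiser `(z, w)` of the game value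
over `Z_ε(μ) × △`. -/
def furthestAnswers (ε : ℝ) (o : Optimality) (μ : Vec d) : Set (Vec d) :=
  {z | z ∈ B.epsOptimal ε μ o ∧ ∃ w ∈ stdSimplex ℝ B.arms,
    ∀ z' ∈ B.epsOptimal ε μ o, ∀ w' ∈ stdSimplex ℝ B.arms,
      B.gameValue ε o μ z' w' ≤ B.gameValue ε o μ z w}

/-- Sample space of the interaction. Coordinate `0` is the internal randomization of the strategy;
coordinate `t ≥ 1` is the observation `X_t` of round `t`. -/
abbrev Trajectory : Type := ℕ → ℝ

/-- The history: `history t` is generated by the internal randomization and the observations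
`X_1, …, X_t`. The arms `a_1, …, a_t` are functions of these, so they generate nothing more. -/
abbrev history : Filtration ℕ (inferInstance : MeasurableSpace Trajectory) :=
  Filtration.piLE (X := fun _ : ℕ => ℝ)

/-- An identification strategy: law of the internal randomization (a strategy without randomization
just ignores it), sampling rule, stopping rule and recommendation rule. -/
structure Strategy where
  /-- Law of the internal randomization. -/
  seedLaw : ProbabilityMeasure ℝ
  /-- `arm n` is the arm pulled in round `n + 1`, given the history up to round `n`. -/
  arm : (n : ℕ) → (Finset.Iic n → ℝ) → B.arms
  measurable_arm : ∀ n, Measurable (arm n)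
  /-- The stopping time. -/
  stopTime : Trajectory → ℕ∞
  isStoppingTime : IsStoppingTime history stopTime
  /-- The recommended answer. -/
  recommend : Trajectory → B.answers
  measurable_recommend : Measurable[isStoppingTime.measurableSpace] recommend

/-- The law of the reward of arm `a` under the parameter `μ`: Gaussian with mean `⟨μ, a⟩` and
variance `1`. -/
def rewardKernel (μ : Vec d) : Kernel B.arms ℝ :=
  Kernel.ofFunOfCountable (fun a => gaussianReal (inner ℝ μ (a : Vec d)) 1)

instance (μ : Vec d) : IsMarkovKernel (B.rewardKernel μ) :=
  ⟨fun a => inferInstanceAs (IsProbabilityMeasure (gaussianReal (inner ℝ μ (a : Vec d)) 1))⟩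

namespace Strategy

variable {B} (s : B.Strategy)

/-- The conditional law of the observation of round `n + 1` given the history up to round `n`. -/
def stepKernel (μ : Vec d) (n : ℕ) : Kernel (Finset.Iic n → ℝ) ℝ :=
  (B.rewardKernel μ).comap (s.arm n) (s.measurable_arm n)

instance (μ : Vec d) (n : ℕ) : IsMarkovKernel (s.stepKernel μ n) := by
  unfold stepKernel; infer_instance

/-- The law `ℙ_μ` of the interaction of the strategy with the bandit of parameter `μ`. -/
def law (μ : Vec d) : Measure Trajectory :=
  Measure.bind ((s.seedLaw : Measure ℝ).map (fun u (_ : Finset.Iic 0) => u))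
    (Kernel.traj (X := fun _ : ℕ => ℝ) (s.stepKernel μ) 0)

/-- The expected sample complexity `𝔼_μ[τ]`, in `[0, ∞]`. -/
def expectedTime (μ : Vec d) : ℝ≥0∞ :=
  ∫⁻ x, (s.stopTime x : ℝ≥0∞) ∂(s.law μ)

/-- `(ε, δ)`-PAC: for every `μ ∈ M`, `ℙ_μ[τ < ∞, ẑ ∉ Z_ε(μ)] ≤ δ`. -/
def IsPAC (ε : ℝ) (o : Optimality) (δ : ℝ) : Prop :=
  ∀ μ ∈ B.params,
    s.law μ {x | s.stopTime x < ⊤ ∧ (s.recommend x : Vec d) ∉ B.epsOptimal ε μ o} ≤ ENNReal.ofReal δ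

end Strategy

/-- A family of strategies indexed by the confidence level `δ ∈ (0,1)` (values at other reals are
irrelevant), each of them `(ε, δ)`-PAC. -/
def IsPACFamily (ε : ℝ) (o : Optimality) (s : ℝ → B.Strategy) : Prop :=
  ∀ δ ∈ Set.Ioo (0 : ℝ) 1, (s δ).IsPAC ε o δ

/-- Asymptotically greedy: for every `μ ∈ M`,
`ℙ_μ[τ_δ < ∞, ẑ ∈ Z_ε(μ) \ z⋆(μ)] → 0` as `δ → 0`. -/
def IsAsymptoticallyGreedy (ε : ℝ) (o : Optimality) (s : ℝ → B.Strategy) : Prop :=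
  ∀ μ ∈ B.params,
    Tendsto (fun δ => (s δ).law μ {x | (s δ).stopTime x < ⊤ ∧
      ((s δ).recommend x : Vec d) ∈ B.epsOptimal ε μ o \ B.greedyAnswers μ}) (𝓝[>] 0) (𝓝 0)

/-- `liminf_{δ → 0} 𝔼_μ[τ_δ] / ln(1/δ)`. -/
def asymptoticComplexity (s : ℝ → B.Strategy) (μ : Vec d) : ℝ≥0∞ :=
  liminf (fun δ : ℝ => (s δ).expectedTime μ / ENNReal.ofReal (Real.log (1 / δ))) (𝓝[>] 0)

end Problem

end EpsBAI

end

open MeasureTheory ProbabilityTheory Filter Topology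
open scoped ENNReal

noncomputable section

/-! ### Change of measure along a trajectory. -/

namespace EpsBAI

namespace Problem

variable {d : ℕ} {B : Problem d}

/-! Fix `A < A' < T_g`, write `L = ln(1/δ)`, `n = ⌊A L⌋`, `c = 1/A'`, and consider the event `τ ≤ n`
under `μ`. The recommendation is not `ε`-optimal with probability at most `δ`, and is `ε`-optimal
but not greedy with vanishing probability, so only a greedy answer `z` matters. For such `z` every
allocation has game value below `c`, in particular the empirical allocation of the first `n` rounds.
By compactness of the simplex, one of finitely many alternatives `l`, for which `z` is wrong, has
accumulated information at most `n c ≤ A c L` with `A c < 1` (`exists_finset_alternatives`,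
`exists_energy_le`).

The PAC property at `l` gives the event "stop by `n`, answer `z`, little information against `l`"
probability at most `δ = exp(-L)` under `l`. Passing to `μ` costs about `exp(A c L)` up to Gaussian
fluctuations (`law_le_of_energy_le`), so the probability under `μ` also vanishes
(`tendsto_law_wrong_answer`). A finite union bound yields `P_μ[τ ≤ n] → 0`. Markov's inequality and
`A ↑ T_g` then give (i). Splitting by the recommended answer and by the alternative handles several
greedy answers and adaptive sampling without any limit of allocations.

Part (ii) is a comparison of attained maxima: if the two suprema agree, a greedy maximiser is a
furthest answer. Part (iii) chains (i) and (ii). -/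

lemma gaussianReal_lintegral_shift (m u : ℝ) (f : ℝ → ℝ≥0∞) (hf : Measurable f) :
    ∫⁻ y, f y ∂(gaussianReal (m + u) 1) =
      ∫⁻ y, f y * ENNReal.ofReal (Real.exp (u * (y - m) - u ^ 2 / 2)) ∂(gaussianReal m 1) := by
  rw [gaussianReal_of_var_ne_zero _ one_ne_zero, gaussianReal_of_var_ne_zero _ one_ne_zero,
    lintegral_withDensity_eq_lintegral_mul _ (measurable_gaussianPDF _ _) hf,
    lintegral_withDensity_eq_lintegral_mul _ (measurable_gaussianPDF _ _) (by fun_prop)]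
  refine lintegral_congr fun y => ?_
  simp only [Pi.mul_apply, gaussianPDF]
  rw [mul_comm (f y), ← mul_assoc, ← ENNReal.ofReal_mul (gaussianPDFReal_nonneg _ _ _)]
  congr 2
  simp only [gaussianPDFReal]
  rw [mul_assoc (√_)⁻¹, ← Real.exp_add]
  congr 2
  push_cast
  ring

namespace Strategy

variable (s : B.Strategy)

lemma law_eq_trajMeasure (μ : Vec d) :
    s.law μ = Kernel.trajMeasure (X := fun _ : ℕ => ℝ) (s.seedLaw : Measure ℝ) (s.stepKernel μ) := by
  rfl

instance (μ : Vec d) : IsProbabilityMeasure (s.law μ) := by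
  rw [law_eq_trajMeasure]; infer_instance

/-- Appending an observation to a history. -/
def extendHistory (n : ℕ) (p : (Finset.Iic n → ℝ) × ℝ) (i : Finset.Iic (n + 1)) : ℝ :=
  if h : (i : ℕ) ≤ n then p.1 ⟨i, Finset.mem_Iic.2 h⟩ else p.2

lemma measurable_extendHistory (n : ℕ) : Measurable (extendHistory n) := by
  refine measurable_pi_lambda _ fun i => ?_
  unfold extendHistory
  split_ifs <;> fun_prop

lemma extendHistory_frestrictLe (n : ℕ) (x : Trajectory) :
    extendHistory n (Preorder.frestrictLe n x, x (n + 1)) = Preorder.frestrictLe (n + 1) x := by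
  ext i
  unfold extendHistory
  split_ifs with h
  · rfl
  · have h1 := Finset.mem_Iic.1 i.2
    have : (i : ℕ) = n + 1 := by omega
    simp [Preorder.frestrictLe, this]

/-- Disintegration of the trajectory law at round `n + 1`, which drives the induction on rounds. -/
lemma lintegral_law_succ (μ : Vec d) (n : ℕ) (g : (Finset.Iic n → ℝ) × ℝ → ℝ≥0∞)
    (hg : Measurable g) :
    ∫⁻ x, g (Preorder.frestrictLe n x, x (n + 1)) ∂(s.law μ) =
      ∫⁻ x, ∫⁻ y, g (Preorder.frestrictLe n x, y) ∂(s.stepKernel μ n (Preorder.frestrictLe n x))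
        ∂(s.law μ) := by
  have h := Kernel.map_frestrictLe_trajMeasure_compProd_eq_map_trajMeasure
    (X := fun _ : ℕ => ℝ) (μ₀ := (s.seedLaw : Measure ℝ)) (κ := s.stepKernel μ) (a := n)
  rw [← law_eq_trajMeasure] at h
  have hm : Measurable (fun x : Trajectory => (Preorder.frestrictLe (π := fun _ : ℕ => ℝ) n x, x (n + 1))) := by
    fun_prop
  rw [← lintegral_map (f := g) hg hm, ← h, Measure.lintegral_compProd hg, lintegral_map]
  · exact hg.lintegral_kernel_prod_right'
  · fun_prop

lemma law_map_frestrictLe_zero (μ l : Vec d) :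
    (s.law μ).map (Preorder.frestrictLe (π := fun _ : ℕ => ℝ) 0) =
      (s.law l).map (Preorder.frestrictLe (π := fun _ : ℕ => ℝ) 0) := by
  unfold law
  rw [Measure.map_comp _ _ (by fun_prop), Measure.map_comp _ _ (by fun_prop),
    Kernel.traj_map_frestrictLe, Kernel.traj_map_frestrictLe, Kernel.partialTraj_self,
    Kernel.partialTraj_self]

/-- The increment of the martingale part of the log-likelihood ratio in the direction `θ`. -/
def noiseTerm (μ θ : Vec d) (n : ℕ) (h : Finset.Iic n → ℝ) (y : ℝ) : ℝ :=
  inner ℝ θ (s.arm n h : Vec d) * (y - inner ℝ μ (s.arm n h : Vec d))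

/-- The martingale part of the log-likelihood ratio in the direction `θ`. -/
def noise (μ θ : Vec d) (n : ℕ) (x : Trajectory) : ℝ :=
  ∑ k ∈ Finset.range n, s.noiseTerm μ θ k (Preorder.frestrictLe k x) (x (k + 1))

/-- The information accumulated during the first `n` rounds in the direction `θ`. -/
def energy (θ : Vec d) (n : ℕ) (x : Trajectory) : ℝ :=
  ∑ k ∈ Finset.range n, inner ℝ θ (s.arm k (Preorder.frestrictLe k x) : Vec d) ^ 2

lemma measurable_inner_arm (θ : Vec d) (n : ℕ) :
    Measurable fun h : Finset.Iic n → ℝ => (inner ℝ θ (s.arm n h : Vec d) : ℝ) :=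
  (measurable_of_countable (fun a : B.arms => (inner ℝ θ (a : Vec d) : ℝ))).comp (s.measurable_arm n)

lemma measurable_noiseTerm (μ θ : Vec d) (n : ℕ) :
    Measurable fun p : (Finset.Iic n → ℝ) × ℝ => s.noiseTerm μ θ n p.1 p.2 := by
  have h1 : Measurable fun p : (Finset.Iic n → ℝ) × ℝ => (inner ℝ θ (s.arm n p.1 : Vec d) : ℝ) :=
    (s.measurable_inner_arm θ n).comp measurable_fst
  have h2 : Measurable fun p : (Finset.Iic n → ℝ) × ℝ => (inner ℝ μ (s.arm n p.1 : Vec d) : ℝ) :=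
    (s.measurable_inner_arm μ n).comp measurable_fst
  exact h1.mul (measurable_snd.sub h2)

lemma history_eq_comap (n : ℕ) :
    (history n : MeasurableSpace Trajectory) =
      MeasurableSpace.pi.comap (Preorder.frestrictLe (π := fun _ : ℕ => ℝ) n) :=
  Filtration.piLE_eq_comap_frestrictLe n

lemma measurable_frestrictLe_history {k n : ℕ} (h : k ≤ n) :
    Measurable[history n] (Preorder.frestrictLe (π := fun _ : ℕ => ℝ) k) := by
  refine Measurable.mono ?_ (history.mono h) le_rfl
  rw [history_eq_comap]
  exact comap_measurable _

lemma measurable_eval_history {k n : ℕ} (h : k ≤ n) :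
    Measurable[history n] (fun x : Trajectory => x k) :=
  (measurable_pi_apply (⟨k, Finset.mem_Iic.2 le_rfl⟩ : Finset.Iic k)).comp
    (measurable_frestrictLe_history h)

lemma measurable_noise (μ θ : Vec d) (n : ℕ) : Measurable[history n] (s.noise μ θ n) := by
  refine Finset.measurable_fun_sum _ fun k hk => ?_
  have hk := Finset.mem_range.1 hk
  exact (s.measurable_noiseTerm μ θ k).comp
    ((measurable_frestrictLe_history hk.le).prodMk (measurable_eval_history hk))

lemma measurable_energy (θ : Vec d) (n : ℕ) : Measurable[history n] (s.energy θ n) := by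
  refine Finset.measurable_fun_sum _ fun k hk => ?_
  have hk := Finset.mem_range.1 hk
  exact ((s.measurable_inner_arm θ k).comp (measurable_frestrictLe_history hk.le)).pow_const 2

/-- The likelihood ratio of `ℙ_{μ + θ}` against `ℙ_μ` on the first `n` rounds. -/
def likelihood (μ θ : Vec d) (n : ℕ) (x : Trajectory) : ℝ≥0∞ :=
  ENNReal.ofReal (Real.exp (s.noise μ θ n x - s.energy θ n x / 2))

lemma measurable_likelihood (μ θ : Vec d) (n : ℕ) :
    Measurable[history n] (s.likelihood μ θ n) :=
  (((s.measurable_noise μ θ n).sub ((s.measurable_energy θ n).div_const 2)).exp).ennreal_ofReal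

lemma exists_eq_comp_frestrictLe {n : ℕ} {f : Trajectory → ℝ≥0∞} (hf : Measurable[history n] f) :
    ∃ g : (Finset.Iic n → ℝ) → ℝ≥0∞, Measurable g ∧ f = g ∘ Preorder.frestrictLe n := by
  rw [history_eq_comap] at hf
  obtain ⟨g, hg, h⟩ := hf.exists_eq_measurable_comp
  exact ⟨g, hg, h⟩

/-- The likelihood ratio of the observation of round `n + 1`. -/
def stepLikelihood (μ θ : Vec d) (n : ℕ) (p : (Finset.Iic n → ℝ) × ℝ) : ℝ≥0∞ :=
  ENNReal.ofReal (Real.exp (s.noiseTerm μ θ n p.1 p.2 - inner ℝ θ (s.arm n p.1 : Vec d) ^ 2 / 2))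

lemma measurable_stepLikelihood (μ θ : Vec d) (n : ℕ) : Measurable (s.stepLikelihood μ θ n) := by
  have h2 : Measurable fun p : (Finset.Iic n → ℝ) × ℝ => (inner ℝ θ (s.arm n p.1 : Vec d) : ℝ) :=
    (s.measurable_inner_arm θ n).comp measurable_fst
  exact (((s.measurable_noiseTerm μ θ n).sub ((h2.pow_const 2).div_const 2)).exp).ennreal_ofReal

lemma lintegral_stepKernel_add (μ θ : Vec d) (n : ℕ) (h : Finset.Iic n → ℝ) (f : ℝ → ℝ≥0∞)
    (hf : Measurable f) :
    ∫⁻ y, f y ∂(s.stepKernel (μ + θ) n h) =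
      ∫⁻ y, f y * s.stepLikelihood μ θ n (h, y) ∂(s.stepKernel μ n h) := by
  have hk (ν : Vec d) : s.stepKernel ν n h = gaussianReal (inner ℝ ν (s.arm n h : Vec d)) 1 := rfl
  rw [hk, hk, inner_add_left, gaussianReal_lintegral_shift _ _ _ hf]
  rfl

lemma likelihood_succ (μ θ : Vec d) (n : ℕ) (x : Trajectory) :
    s.likelihood μ θ (n + 1) x = s.likelihood μ θ n x *
      s.stepLikelihood μ θ n (Preorder.frestrictLe n x, x (n + 1)) := by
  unfold likelihood noise energy stepLikelihood
  rw [← ENNReal.ofReal_mul (Real.exp_nonneg _), ← Real.exp_add, Finset.sum_range_succ,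
    Finset.sum_range_succ]
  congr 2
  ring

/-- Integrate out the last observation under `μ + θ`, move the prefix to `μ` by `ih`, shift the last
Gaussian, and reassemble under `μ`. The prefix likelihood depends only on the history, so it passes
through the inner integral. -/
lemma lintegral_law_add_succ (μ θ : Vec d) (n : ℕ)
    (ih : ∀ g : (Finset.Iic n → ℝ) → ℝ≥0∞, Measurable g →
      ∫⁻ x, g (Preorder.frestrictLe n x) ∂(s.law (μ + θ)) =
        ∫⁻ x, g (Preorder.frestrictLe n x) * s.likelihood μ θ n x ∂(s.law μ))
    (G : (Finset.Iic n → ℝ) × ℝ → ℝ≥0∞) (hG : Measurable G) :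
    ∫⁻ x, G (Preorder.frestrictLe n x, x (n + 1)) ∂(s.law (μ + θ)) =
      ∫⁻ x, G (Preorder.frestrictLe n x, x (n + 1)) * s.likelihood μ θ (n + 1) x ∂(s.law μ) := by
  obtain ⟨ℓ, hℓ, hℓe⟩ := exists_eq_comp_frestrictLe (s.measurable_likelihood μ θ n)
  have hr := s.measurable_stepLikelihood μ θ n
  rw [s.lintegral_law_succ _ _ _ hG]
  rw [ih (fun h => ∫⁻ y, G (h, y) ∂(s.stepKernel (μ + θ) n h)) hG.lintegral_kernel_prod_right']
  have hR := s.lintegral_law_succ μ n (fun p => G p * s.stepLikelihood μ θ n p * ℓ p.1)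
    ((hG.mul hr).mul (hℓ.comp measurable_fst))
  calc _ = _ := ?_
    _ = _ := hR.symm
    _ = _ := ?_
  · refine lintegral_congr fun x => ?_
    rw [s.lintegral_stepKernel_add μ θ n _ (fun y => G (Preorder.frestrictLe n x, y))
      (hG.comp measurable_prodMk_left), hℓe]
    exact (lintegral_mul_const _
      ((hG.comp measurable_prodMk_left).mul (hr.comp measurable_prodMk_left))).symm
  · refine lintegral_congr fun x => ?_
    rw [likelihood_succ, hℓe, Function.comp_apply, mul_assoc, mul_comm (ℓ _)]

/-- Change of measure on the first `n` rounds. -/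
theorem lintegral_law_add (μ θ : Vec d) (n : ℕ) (g : (Finset.Iic n → ℝ) → ℝ≥0∞)
    (hg : Measurable g) :
    ∫⁻ x, g (Preorder.frestrictLe n x) ∂(s.law (μ + θ)) =
      ∫⁻ x, g (Preorder.frestrictLe n x) * s.likelihood μ θ n x ∂(s.law μ) := by
  induction n with
  | zero =>
    have h0 : ∀ x, s.likelihood μ θ 0 x = 1 := by simp [likelihood, noise, energy]
    simp_rw [h0, mul_one]
    rw [← lintegral_map (g := Preorder.frestrictLe (π := fun _ : ℕ => ℝ) 0) hg (by fun_prop),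
      ← lintegral_map (g := Preorder.frestrictLe (π := fun _ : ℕ => ℝ) 0) hg (by fun_prop),
      s.law_map_frestrictLe_zero μ (μ + θ)]
  | succ n ih =>
    -- A function of the longer history is a function of the pair (shorter history, new observation)
    -- via `extendHistory`.
    have h := s.lintegral_law_add_succ μ θ n ih _ (hg.comp (measurable_extendHistory n))
    simpa only [Function.comp_apply, extendHistory_frestrictLe] using h

lemma law_add_apply (μ θ : Vec d) (n : ℕ) {E : Set Trajectory} (hE : MeasurableSet[history n] E) :
    s.law (μ + θ) E = ∫⁻ x in E, s.likelihood μ θ n x ∂(s.law μ) := by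
  have hE' := history.le n _ hE
  rw [history_eq_comap] at hE
  obtain ⟨S, hS, rfl⟩ := hE
  have h := s.lintegral_law_add μ θ n (S.indicator 1) (measurable_one.indicator hS)
  rw [← lintegral_indicator hE', ← lintegral_indicator_one hE']
  refine Eq.trans h (lintegral_congr fun x => ?_)
  by_cases hx : Preorder.frestrictLe n x ∈ S
  · rw [Set.indicator_of_mem hx, Set.indicator_of_mem (Set.mem_preimage.2 hx), Pi.one_apply, one_mul]
  · rw [Set.indicator_of_notMem hx, zero_mul]
    have hx' : x ∉ Preorder.frestrictLe n ⁻¹' S := fun h => hx h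
    exact (Set.indicator_of_notMem hx' (s.likelihood μ θ n)).symm

/-! ### Deviations of the likelihood ratio. -/

lemma noise_smul (μ θ : Vec d) (c : ℝ) (n : ℕ) (x : Trajectory) :
    s.noise μ (c • θ) n x = c * s.noise μ θ n x := by
  simp only [noise, noiseTerm, inner_smul_left, Finset.mul_sum]
  refine Finset.sum_congr rfl fun k _ => ?_
  simp; ring

lemma energy_smul (θ : Vec d) (c : ℝ) (n : ℕ) (x : Trajectory) :
    s.energy (c • θ) n x = c ^ 2 * s.energy θ n x := by
  simp only [energy, inner_smul_left, Finset.mul_sum]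
  refine Finset.sum_congr rfl fun k _ => ?_
  simp; ring

lemma energy_le (θ : Vec d) {C : ℝ} (hC : ∀ a ∈ B.arms, inner ℝ θ a ^ 2 ≤ C) (n : ℕ)
    (x : Trajectory) : s.energy θ n x ≤ n * C := by
  unfold energy
  calc _ ≤ ∑ k ∈ Finset.range n, C :=
        Finset.sum_le_sum fun k _ => hC _ (s.arm k (Preorder.frestrictLe k x)).2
    _ = _ := by simp

/-- Exponential deviation inequality for the noise term. -/
lemma law_noise_lt_le (μ θ : Vec d) {C : ℝ} (hC : ∀ a ∈ B.arms, inner ℝ θ a ^ 2 ≤ C) (n : ℕ)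
    {t : ℝ} (ht : 0 ≤ t) (y : ℝ) :
    s.law μ {x | s.noise μ θ n x < -y} ≤
      ENNReal.ofReal (Real.exp (-(t * y - t ^ 2 * (n * C) / 2))) := by
  -- Chernoff's method: the exponential supermartingale bound comes for free, since the likelihood
  -- in direction `-tθ` integrates to the total mass of another law.
  have hone : ∫⁻ x, s.likelihood μ ((-t) • θ) n x ∂(s.law μ) = 1 := by
    have := s.law_add_apply μ ((-t) • θ) n (@MeasurableSet.univ _ (history n))
    rw [Measure.restrict_univ, measure_univ] at this
    exact this.symm
  have hsub : {x | s.noise μ θ n x < -y} ⊆ {x | ENNReal.ofReal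
      (Real.exp (t * y - t ^ 2 * (n * C) / 2)) ≤ s.likelihood μ ((-t) • θ) n x} := by
    intro x hx
    simp only [Set.mem_ofPred_eq] at hx ⊢
    refine ENNReal.ofReal_le_ofReal (Real.exp_le_exp.2 ?_)
    rw [noise_smul, energy_smul]
    have h1 := mul_le_mul_of_nonneg_left hx.le ht
    have h2 := mul_le_mul_of_nonneg_left (s.energy_le θ hC n x) (sq_nonneg t)
    nlinarith
  have hmk := mul_meas_ge_le_lintegral (μ := s.law μ)
    ((s.measurable_likelihood μ ((-t) • θ) n).mono (history.le n) le_rfl)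
    (ENNReal.ofReal (Real.exp (t * y - t ^ 2 * (n * C) / 2)))
  rw [hone] at hmk
  rw [Real.exp_neg, ENNReal.ofReal_inv_of_pos (Real.exp_pos _)]
  refine (measure_mono hsub).trans ?_
  rw [ENNReal.le_inv_iff_mul_le, mul_comm]
  exact hmk

/-- Transfer of the probability of an event on which the accumulated information is small. -/
lemma law_le_of_energy_le (μ θ : Vec d) {C : ℝ} (hC : ∀ a ∈ B.arms, inner ℝ θ a ^ 2 ≤ C) (n : ℕ)
    {t : ℝ} (ht : 0 ≤ t) (y q : ℝ) {E : Set Trajectory} (hE : MeasurableSet[history n] E)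
    (hq : ∀ x ∈ E, s.energy θ n x / 2 ≤ q) :
    s.law μ E ≤ ENNReal.ofReal (Real.exp (y + q)) * s.law (μ + θ) E +
      ENNReal.ofReal (Real.exp (-(t * y - t ^ 2 * (n * C) / 2))) := by
  have hN : MeasurableSet {x | s.noise μ θ n x < -y} :=
    measurableSet_lt ((s.measurable_noise μ θ n).mono (history.le n) le_rfl) measurable_const
  have hE' := history.le n _ hE
  -- Off the event that the noise is below `-y`, the likelihood ratio on `E` is at least `exp(-(y +
  -- q))`.
  rw [← measure_sdiff_add_inter E hN]
  refine add_le_add ?_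
    ((measure_mono Set.inter_subset_right).trans (s.law_noise_lt_le μ θ hC n ht y))
  have h1 : ENNReal.ofReal (Real.exp (-(y + q))) * s.law μ (E \ {x | s.noise μ θ n x < -y}) ≤
      s.law (μ + θ) E := by
    rw [s.law_add_apply μ θ n hE, ← setLIntegral_const]
    refine (setLIntegral_mono' (hE'.diff hN) fun x hx => ?_).trans
      (lintegral_mono_set Set.sdiff_subset)
    refine ENNReal.ofReal_le_ofReal (Real.exp_le_exp.2 ?_)
    have := hq x hx.1
    have h2 : -y ≤ s.noise μ θ n x := not_lt.1 fun h => hx.2 h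
    linarith
  calc s.law μ (E \ {x | s.noise μ θ n x < -y})
      = ENNReal.ofReal (Real.exp (y + q)) * (ENNReal.ofReal (Real.exp (-(y + q))) *
          s.law μ (E \ {x | s.noise μ θ n x < -y})) := by
        rw [← mul_assoc, ← ENNReal.ofReal_mul (Real.exp_nonneg _), ← Real.exp_add]
        simp
    _ ≤ _ := by gcongr

/-- Allows the change of measure at a deterministic time `n` to be applied to decisions taken at the
stopping time. -/
lemma measurableSet_stop_recommend (n : ℕ) (z : Vec d) :
    MeasurableSet[history n] {x | s.stopTime x ≤ n ∧ (s.recommend x : Vec d) = z} := by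
  have h : MeasurableSet[s.isStoppingTime.measurableSpace] {x | (s.recommend x : Vec d) = z} :=
    s.measurable_recommend (measurable_subtype_coe (measurableSet_singleton z))
  have h2 := ((s.isStoppingTime.measurableSet _).1 h).2 n
  convert h2 using 1
  ext x
  exact and_comm

end Strategy
end Problem
end EpsBAI

/-! ### The game: compactness, attained maxima, and part (ii). -/

namespace EpsBAI

namespace Problem

variable {d : ℕ} {B : Problem d}

lemma dotProduct_designMatrix_mulVec (w : B.arms → ℝ) (x : Vec d) :
    x.ofLp ⬝ᵥ (B.designMatrix w).mulVec x.ofLp = ∑ a : B.arms, w a * inner ℝ x (a : Vec d) ^ 2 := by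
  have hin (a : Vec d) : inner ℝ x a = x.ofLp ⬝ᵥ a.ofLp := by
    simp [PiLp.inner_apply, dotProduct, mul_comm]
  simp only [designMatrix, Matrix.sum_mulVec, dotProduct_sum, Matrix.smul_mulVec, dotProduct_smul,
    hin, smul_eq_mul, Matrix.vecMulVec_mulVec, op_smul_eq_smul]
  refine Finset.sum_congr rfl fun a _ => ?_
  rw [dotProduct_comm (a : Vec d).ofLp]
  ring

lemma seminormOf_designMatrix_sq {w : B.arms → ℝ} (hw : ∀ a, 0 ≤ w a) (x : Vec d) :
    seminormOf (B.designMatrix w) x ^ 2 = ∑ a : B.arms, w a * inner ℝ x (a : Vec d) ^ 2 := by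
  rw [seminormOf, dotProduct_designMatrix_mulVec, Real.sq_sqrt]
  exact Finset.sum_nonneg fun a _ => mul_nonneg (hw a) (sq_nonneg _)

/-- An infimum of functions continuous in `w`. Upper semicontinuity suffices for a maximum on the
simplex. -/
lemma upperSemicontinuous_gameValue (ε : ℝ) (o : Optimality) (μ z : Vec d) :
    UpperSemicontinuous (B.gameValue ε o μ z) := by
  unfold gameValue
  refine upperSemicontinuous_biInf fun l _ => Continuous.upperSemicontinuous ?_
  simp only [seminormOf, dotProduct_designMatrix_mulVec]
  exact ENNReal.continuous_ofReal.comp (by fun_prop)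

lemma exists_isMaxOn_gameValue (ε : ℝ) (o : Optimality) (μ z : Vec d) :
    ∃ w ∈ stdSimplex ℝ B.arms, IsMaxOn (B.gameValue ε o μ z) (stdSimplex ℝ B.arms) w := by
  classical
  obtain ⟨a, ha⟩ := B.arms_nonempty
  exact ((upperSemicontinuous_gameValue ε o μ z).upperSemicontinuousOn _).exists_isMaxOn
    ⟨_, single_mem_stdSimplex ℝ (⟨a, ha⟩ : B.arms)⟩ (isCompact_stdSimplex ℝ B.arms)

lemma greedyAnswers_nonempty (μ : Vec d) : (B.greedyAnswers μ).Nonempty := by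
  obtain ⟨z, hz, h⟩ := B.answers.exists_max_image (fun z => (inner ℝ μ z : ℝ)) B.answers_nonempty
  exact ⟨z, hz, h⟩

lemma greedyAnswers_subset_epsOptimal {ε : ℝ} (hε : 0 ≤ ε) {o : Optimality} (hB : B.Admissible o)
    {μ : Vec d} (hμ : μ ∈ B.params) : B.greedyAnswers μ ⊆ B.epsOptimal ε μ o := by
  rintro z ⟨hz, h⟩
  have hmax : B.maxValue μ ≤ inner ℝ μ z := Finset.sup'_le _ _ h
  cases o with
  | additive => exact ⟨hz, by linarith⟩
  | multiplicative =>
    have := hB μ hμ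
    -- Positivity of the maximum is what makes `(1 - ε) * max ≤ max`.
    exact ⟨hz, by nlinarith⟩

/-- A greedy answer achieves the inner supremum of the greedy characteristic time. -/
lemma exists_greedy_maximizer (ε : ℝ) (o : Optimality) (μ : Vec d) :
    ∃ z ∈ B.greedyAnswers μ, ∃ w ∈ stdSimplex ℝ B.arms,
      (⨆ z ∈ B.greedyAnswers μ, ⨆ w ∈ stdSimplex ℝ B.arms, B.gameValue ε o μ z w) =
        B.gameValue ε o μ z w := by
  have hfin : (B.greedyAnswers μ).Finite := B.answers.finite_toSet.subset fun z hz => hz.1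
  choose w hw hmax using fun z => B.exists_isMaxOn_gameValue ε o μ z
  obtain ⟨z, hz, hzmax⟩ := hfin.exists_maximalFor (fun z => B.gameValue ε o μ z (w z)) _
    (B.greedyAnswers_nonempty μ)
  refine ⟨z, hz, w z, hw z, le_antisymm ?_ ?_⟩
  · refine iSup₂_le fun z' hz' => iSup₂_le fun w' hw' => (hmax z' hw').trans ?_
    rcases le_total (B.gameValue ε o μ z' (w z')) (B.gameValue ε o μ z (w z)) with h | h
    · exact h
    · exact hzmax hz' h
  · exact (le_iSup₂ (f := fun w' _ => B.gameValue ε o μ z w') (w z) (hw z)).trans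
      (le_iSup₂ (f := fun z' _ => ⨆ w' ∈ stdSimplex ℝ B.arms, B.gameValue ε o μ z' w') z hz)

/-- A greedy furthest answer makes the two suprema equal. Conversely, if they are equal, the
attained greedy maximum is a global one, so its answer is furthest and uniqueness identifies it with
`zF`. -/
theorem charTime_lt_greedyCharTime_iff {ε : ℝ} (hε : 0 ≤ ε) {o : Optimality}
    (hB : B.Admissible o) {μ : Vec d} (hμ : μ ∈ B.params) {zF : Vec d}
    (hF : B.furthestAnswers ε o μ = {zF}) :
    B.charTime ε o μ < B.greedyCharTime ε o μ ↔ zF ∉ B.greedyAnswers μ := by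
  have hsub := B.greedyAnswers_subset_epsOptimal hε hB hμ
  rw [charTime, greedyCharTime, ENNReal.inv_lt_inv]
  constructor
  · intro hlt hz
    refine hlt.not_ge ?_
    obtain ⟨-, w, hw, hmax⟩ : zF ∈ B.furthestAnswers ε o μ := hF ▸ rfl
    exact (iSup₂_le fun z' hz' => iSup₂_le fun w' hw' => hmax z' hz' w' hw').trans
      ((le_iSup₂ (f := fun w' _ => B.gameValue ε o μ zF w') w hw).trans
        (le_iSup₂ (f := fun z' _ => ⨆ w' ∈ stdSimplex ℝ B.arms, B.gameValue ε o μ z' w') zF hz))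
  · intro hz
    refine lt_of_le_of_ne (biSup_mono fun z hz' => hsub hz') fun heq => hz ?_
    obtain ⟨z, hzg, w, hw, hval⟩ := B.exists_greedy_maximizer ε o μ
    have hmem : z ∈ B.furthestAnswers ε o μ := by
      refine ⟨hsub hzg, w, hw, fun z' hz' w' hw' => ?_⟩
      rw [← hval, heq]
      exact (le_iSup₂ (f := fun w' _ => B.gameValue ε o μ z' w') w' hw').trans
        (le_iSup₂ (f := fun z' _ => ⨆ w' ∈ stdSimplex ℝ B.arms, B.gameValue ε o μ z' w') z' hz')
    rw [hF, Set.mem_singleton_iff] at hmem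
    exact hmem ▸ hzg

lemma exists_alternative_of_gameValue_lt {ε : ℝ} {o : Optimality} {μ z : Vec d} {c : ℝ}
    {w : B.arms → ℝ} (hw : w ∈ stdSimplex ℝ B.arms)
    (h : B.gameValue ε o μ z w < ENNReal.ofReal c) :
    ∃ l ∈ B.params, z ∉ B.epsOptimal ε l o ∧
      1 / 2 * ∑ a : B.arms, w a * inner ℝ (l - μ) (a : Vec d) ^ 2 < c := by
  simp only [gameValue, iInf_lt_iff] at h
  obtain ⟨l, hl, hlc⟩ := h
  rw [seminormOf_designMatrix_sq hw.1] at hlc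
  have hopen : IsOpen {l : Vec d | 1 / 2 * ∑ a : B.arms, w a * inner ℝ (μ - l) (a : Vec d) ^ 2 < c} :=
    isOpen_lt (by fun_prop) continuous_const
  -- The bound is strict and continuous in `l`, so a point of the closure can be replaced by a
  -- genuine parameter, where the PAC property is available.
  obtain ⟨l', hl', hp, hz⟩ := mem_closure_iff.1 hl _ hopen
    (lt_of_not_ge fun hge => hlc.not_ge (ENNReal.ofReal_le_ofReal hge))
  refine ⟨l', hp, hz, ?_⟩
  have hneg (a : B.arms) : inner ℝ (l' - μ) (a : Vec d) ^ 2 = inner ℝ (μ - l') (a : Vec d) ^ 2 := by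
    rw [← neg_sub, inner_neg_left, neg_sq]
  simp only [hneg]
  exact hl'

/-- By compactness of the simplex, finitely many alternatives defeat every allocation. -/
lemma exists_finset_alternatives {ε : ℝ} {o : Optimality} {μ z : Vec d} {c : ℝ}
    (h : ∀ w ∈ stdSimplex ℝ B.arms, B.gameValue ε o μ z w < ENNReal.ofReal c) :
    ∃ t : Finset (Vec d), (∀ l ∈ t, l ∈ B.params ∧ z ∉ B.epsOptimal ε l o) ∧
      ∀ w ∈ stdSimplex ℝ B.arms, ∃ l ∈ t,
        1 / 2 * ∑ a : B.arms, w a * inner ℝ (l - μ) (a : Vec d) ^ 2 < c := by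
  classical
  obtain ⟨t, ht⟩ := (isCompact_stdSimplex ℝ B.arms).elim_finite_subcover
    (fun l : {l : Vec d // l ∈ B.params ∧ z ∉ B.epsOptimal ε l o} =>
      {w : B.arms → ℝ | 1 / 2 * ∑ a : B.arms, w a * inner ℝ (l.1 - μ) (a : Vec d) ^ 2 < c})
    (fun l => isOpen_lt (by fun_prop) continuous_const)
    (fun w hw => by
      obtain ⟨l, hl, hz, hlt⟩ := exists_alternative_of_gameValue_lt hw (h w hw)
      exact Set.mem_iUnion.2 ⟨⟨l, hl, hz⟩, hlt⟩)
  refine ⟨t.image Subtype.val, ?_, fun w hw => ?_⟩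
  · intro l hl
    obtain ⟨l', -, rfl⟩ := Finset.mem_image.1 hl
    exact l'.2
  · obtain ⟨l, hl, hlt⟩ := Set.mem_iUnion₂.1 (ht hw)
    exact ⟨l, Finset.mem_image_of_mem _ hl, hlt⟩

/-! ### Early stopping with a given greedy answer. -/

namespace Strategy

/-- The energy in a direction is the one prescribed by the empirical allocation. -/
lemma exists_empirical_allocation (s : B.Strategy) {n : ℕ} (hn : 0 < n) (x : Trajectory) :
    ∃ w ∈ stdSimplex ℝ B.arms, ∀ θ : Vec d,
      s.energy θ n x = n * ∑ a : B.arms, w a * inner ℝ θ (a : Vec d) ^ 2 := by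
  classical
  have hn' : (n : ℝ) ≠ 0 := by positivity
  set p : ℕ → B.arms := fun k => s.arm k (Preorder.frestrictLe k x)
  refine ⟨fun a => (∑ k ∈ Finset.range n, if p k = a then (1 : ℝ) else 0) / n,
    ⟨fun a => by positivity, ?_⟩, fun θ => ?_⟩
  · rw [← Finset.sum_div, Finset.sum_comm]
    simp [hn']
  · simp_rw [div_mul_eq_mul_div, ← Finset.sum_div, mul_div_cancel₀ _ hn', Finset.sum_mul]
    rw [Finset.sum_comm]
    simp [energy, p]

lemma exists_energy_le (s : B.Strategy) {μ : Vec d} {c : ℝ} {t : Finset (Vec d)}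
    (ht : ∀ w ∈ stdSimplex ℝ B.arms, ∃ l ∈ t,
      1 / 2 * ∑ a : B.arms, w a * inner ℝ (l - μ) (a : Vec d) ^ 2 < c)
    {n : ℕ} (hn : 0 < n) (x : Trajectory) : ∃ l ∈ t, s.energy (l - μ) n x / 2 ≤ n * c := by
  obtain ⟨w, hw, he⟩ := s.exists_empirical_allocation hn x
  obtain ⟨l, hl, hlt⟩ := ht w hw
  refine ⟨l, hl, ?_⟩
  rw [he]
  have := mul_le_mul_of_nonneg_left hlt.le (Nat.cast_nonneg (α := ℝ) n)
  linarith

/-- The slack `1 - A * c` is split in two: a noise threshold of `(1 - A * c) / 2 * L`, with `L = log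
(1 / δ)`, leaves `δ * exp (y + q) ≤ exp (-((1 - A * c) / 2 * L))`, and `htC` keeps the quadratic
Chernoff term at most half of the linear one. -/
lemma law_wrong_answer_le {ε : ℝ} {o : Optimality} {s : B.Strategy} {δ : ℝ} (hδ : 0 < δ)
    (hs : s.IsPAC ε o δ) (μ : Vec d) {l z : Vec d} (hl : l ∈ B.params)
    (hz : z ∉ B.epsOptimal ε l o) {A c C : ℝ} (hc : 0 ≤ c)
    (hC0 : 0 ≤ C) (hC : ∀ a ∈ B.arms, inner ℝ (l - μ) a ^ 2 ≤ C) {t : ℝ} (ht : 0 ≤ t)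
    (htC : t * (A * C) ≤ (1 - A * c) / 2) {n : ℕ} (hn : n ≤ A * Real.log (1 / δ))
    (hlog : 0 ≤ Real.log (1 / δ)) :
    s.law μ {x | (s.stopTime x ≤ n ∧ (s.recommend x : Vec d) = z) ∧
        s.energy (l - μ) n x / 2 ≤ n * c} ≤
      ENNReal.ofReal (Real.exp (-((1 - A * c) / 2 * Real.log (1 / δ)))) +
        ENNReal.ofReal (Real.exp (-(t * (1 - A * c) / 4 * Real.log (1 / δ)))) := by
  set L := Real.log (1 / δ) with hL
  have hδL : δ = Real.exp (-L) := by
    rw [hL, one_div, Real.log_inv, neg_neg, Real.exp_log hδ]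
  have hE : MeasurableSet[history n] {x | (s.stopTime x ≤ n ∧ (s.recommend x : Vec d) = z) ∧
        s.energy (l - μ) n x / 2 ≤ n * c} :=
    (s.measurableSet_stop_recommend n z).inter
      ((s.measurable_energy (l - μ) n).div_const 2 measurableSet_Iic)
  have h := s.law_le_of_energy_le μ (l - μ) hC n ht ((1 - A * c) / 2 * L) (n * c) hE
    fun x hx => hx.2
  rw [add_sub_cancel] at h
  refine h.trans (add_le_add ?_ ?_)
  · have hpac : s.law l {x | (s.stopTime x ≤ n ∧ (s.recommend x : Vec d) = z) ∧
        s.energy (l - μ) n x / 2 ≤ n * c} ≤ ENNReal.ofReal δ := by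
      refine (measure_mono fun x hx => ?_).trans (hs l hl)
      refine ⟨lt_of_le_of_lt hx.1.1 (WithTop.coe_lt_top n), ?_⟩
      rw [hx.1.2]
      exact hz
    refine (mul_le_mul_right hpac _).trans ?_
    rw [← ENNReal.ofReal_mul (Real.exp_nonneg _), hδL, ← Real.exp_add]
    refine ENNReal.ofReal_le_ofReal (Real.exp_le_exp.2 ?_)
    have := mul_le_mul_of_nonneg_right hn hc
    linarith
  · refine ENNReal.ofReal_le_ofReal (Real.exp_le_exp.2 (neg_le_neg ?_))
    have h1 : t ^ 2 * (n * C) ≤ t * (t * (A * C)) * L := by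
      have := mul_le_mul_of_nonneg_left (mul_le_mul_of_nonneg_right hn hC0) (sq_nonneg t)
      linarith
    have h2 : t * (t * (A * C)) * L ≤ t * ((1 - A * c) / 2) * L := by gcongr
    linarith

end Strategy

/-! ### Asymptotics as `δ → 0`. -/

lemma tendsto_log_one_div : Tendsto (fun δ : ℝ => Real.log (1 / δ)) (𝓝[>] 0) atTop := by
  simp_rw [one_div]
  exact Real.tendsto_log_atTop.comp tendsto_inv_nhdsGT_zero

lemma tendsto_ofReal_exp_neg_mul {κ : ℝ} (hκ : 0 < κ) :
    Tendsto (fun δ : ℝ => ENNReal.ofReal (Real.exp (-(κ * Real.log (1 / δ))))) (𝓝[>] 0) (𝓝 0) := by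
  rw [← ENNReal.ofReal_zero]
  exact ENNReal.tendsto_ofReal (Real.tendsto_exp_neg_atTop_nhds_zero.comp
    (tendsto_log_one_div.const_mul_atTop hκ))

lemma eventually_mem_Ioo : ∀ᶠ δ : ℝ in 𝓝[>] 0, δ ∈ Set.Ioo (0 : ℝ) 1 :=
  Ioo_mem_nhdsGT one_pos

lemma tendsto_law_wrong_answer {ε : ℝ} {o : Optimality} {s : ℝ → B.Strategy}
    (hs : B.IsPACFamily ε o s) (μ : Vec d) {l z : Vec d} (hl : l ∈ B.params)
    (hz : z ∉ B.epsOptimal ε l o) {A c : ℝ} (hA : 0 ≤ A) (hc : 0 ≤ c) (hAc : A * c < 1) :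
    Tendsto (fun δ => (s δ).law μ {x | ((s δ).stopTime x ≤ ⌊A * Real.log (1 / δ)⌋₊ ∧
      ((s δ).recommend x : Vec d) = z) ∧
        (s δ).energy (l - μ) ⌊A * Real.log (1 / δ)⌋₊ x / 2 ≤ ⌊A * Real.log (1 / δ)⌋₊ * c})
      (𝓝[>] 0) (𝓝 0) := by
  set C : ℝ := ∑ a ∈ B.arms, inner ℝ (l - μ) a ^ 2 with hCdef
  have hC0 : 0 ≤ C := Finset.sum_nonneg fun a _ => sq_nonneg _
  have hC : ∀ a ∈ B.arms, inner ℝ (l - μ) a ^ 2 ≤ C := fun a ha =>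
    Finset.single_le_sum (f := fun a => (inner ℝ (l - μ) a : ℝ) ^ 2) (fun a _ => sq_nonneg _) ha
  have hAC : 0 ≤ A * C := mul_nonneg hA hC0
  -- Chosen so that `t * (A * C + 1) = (1 - A * c) / 2`; the `+ 1` keeps the denominator positive
  -- when `C = 0`.
  set t : ℝ := (1 - A * c) / (2 * (A * C + 1)) with htdef
  have ht : 0 < t := div_pos (by linarith) (by linarith)
  have htC : t * (A * C) ≤ (1 - A * c) / 2 := by
    have : t * (A * C + 1) = (1 - A * c) / 2 := by
      rw [htdef]; field_simp
    linarith
  have hlim := (tendsto_ofReal_exp_neg_mul (κ := (1 - A * c) / 2) (by linarith)).add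
    (tendsto_ofReal_exp_neg_mul (κ := t * (1 - A * c) / 4)
      (div_pos (mul_pos ht (by linarith)) (by norm_num)))
  rw [add_zero] at hlim
  refine tendsto_of_tendsto_of_tendsto_of_le_of_le' tendsto_const_nhds hlim
    (Eventually.of_forall fun _ => zero_le) ?_
  filter_upwards [eventually_mem_Ioo] with δ hδ
  have hlog : 0 ≤ Real.log (1 / δ) := Real.log_nonneg (by
    rw [one_div]; exact (one_lt_inv₀ hδ.1).2 hδ.2 |>.le)
  exact Strategy.law_wrong_answer_le hδ.1 (hs δ hδ) μ hl hz hc hC0 hC ht.le htC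
    (Nat.floor_le (mul_nonneg hA hlog)) hlog

/-- Stopping before a fraction of the greedy characteristic time is asymptotically impossible. -/
lemma tendsto_law_stopTime_le {ε : ℝ} {o : Optimality} {s : ℝ → B.Strategy}
    (hs : B.IsPACFamily ε o s) (hg : B.IsAsymptoticallyGreedy ε o s) {μ : Vec d}
    (hμ : μ ∈ B.params) {A c : ℝ} (hA : 0 < A) (hc : 0 ≤ c) (hAc : A * c < 1)
    (h : ∀ z ∈ B.greedyAnswers μ, ∀ w ∈ stdSimplex ℝ B.arms,
      B.gameValue ε o μ z w < ENNReal.ofReal c) :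
    Tendsto (fun δ => (s δ).law μ {x | (s δ).stopTime x ≤ ⌊A * Real.log (1 / δ)⌋₊})
      (𝓝[>] 0) (𝓝 0) := by
  -- The finite families are made total in `z`, empty for non-greedy answers, so that the union can
  -- run over all of `B.answers`.
  have hcover : ∀ z, ∃ t : Finset (Vec d), (∀ l ∈ t, l ∈ B.params ∧ z ∉ B.epsOptimal ε l o) ∧
      (z ∈ B.greedyAnswers μ → ∀ w ∈ stdSimplex ℝ B.arms, ∃ l ∈ t,
        1 / 2 * ∑ a : B.arms, w a * inner ℝ (l - μ) (a : Vec d) ^ 2 < c) := by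
    intro z
    by_cases hz : z ∈ B.greedyAnswers μ
    · obtain ⟨t, h1, h2⟩ := exists_finset_alternatives (h z hz)
      exact ⟨t, h1, fun _ => h2⟩
    · exact ⟨∅, by simp, fun h => absurd h hz⟩
  choose t ht hcov using hcover
  have hsum : Tendsto (fun δ => ∑ z ∈ B.answers, ∑ l ∈ t z,
      (s δ).law μ {x | ((s δ).stopTime x ≤ ⌊A * Real.log (1 / δ)⌋₊ ∧
      ((s δ).recommend x : Vec d) = z) ∧
        (s δ).energy (l - μ) ⌊A * Real.log (1 / δ)⌋₊ x / 2 ≤ ⌊A * Real.log (1 / δ)⌋₊ * c})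
      (𝓝[>] 0) (𝓝 0) := by
    have := tendsto_finsetSum (f := fun z δ => ∑ l ∈ t z,
      (s δ).law μ {x | ((s δ).stopTime x ≤ ⌊A * Real.log (1 / δ)⌋₊ ∧
      ((s δ).recommend x : Vec d) = z) ∧
        (s δ).energy (l - μ) ⌊A * Real.log (1 / δ)⌋₊ x / 2 ≤ ⌊A * Real.log (1 / δ)⌋₊ * c})
      (x := 𝓝[>] 0) (a := fun _ => 0) B.answers fun z _ => by
        have := tendsto_finsetSum (f := fun l δ =>
          (s δ).law μ {x | ((s δ).stopTime x ≤ ⌊A * Real.log (1 / δ)⌋₊ ∧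
          ((s δ).recommend x : Vec d) = z) ∧
            (s δ).energy (l - μ) ⌊A * Real.log (1 / δ)⌋₊ x / 2 ≤ ⌊A * Real.log (1 / δ)⌋₊ * c})
          (x := 𝓝[>] 0) (a := fun _ => 0) (t z) fun l hl =>
            tendsto_law_wrong_answer hs μ (ht z l hl).1 (ht z l hl).2 hA.le hc hAc
        simpa using this
    simpa using this
  have hδ0 : Tendsto (fun δ : ℝ => ENNReal.ofReal δ) (𝓝[>] 0) (𝓝 0) := by
    rw [← ENNReal.ofReal_zero]
    exact ENNReal.tendsto_ofReal (tendsto_id.mono_left nhdsWithin_le_nhds)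
  have hlim := (hδ0.add (hg μ hμ)).add hsum
  rw [add_zero, add_zero] at hlim
  refine tendsto_of_tendsto_of_tendsto_of_le_of_le' tendsto_const_nhds hlim
    (Eventually.of_forall fun _ => zero_le) ?_
  -- The empirical allocation exists only after at least one round.
  have hfloor : ∀ᶠ δ : ℝ in 𝓝[>] 0, 0 < ⌊A * Real.log (1 / δ)⌋₊ :=
    (tendsto_nat_floor_atTop.comp (tendsto_log_one_div.const_mul_atTop hA)).eventually_gt_atTop 0
  filter_upwards [eventually_mem_Ioo, hfloor] with δ hδ hn
  set n := ⌊A * Real.log (1 / δ)⌋₊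
  refine le_trans ?_ (add_le_add_left (add_le_add_left (hs δ hδ μ hμ) _) _)
  refine (measure_mono (t := ({x | (s δ).stopTime x < ⊤ ∧
      ((s δ).recommend x : Vec d) ∉ B.epsOptimal ε μ o} ∪ {x | (s δ).stopTime x < ⊤ ∧
      ((s δ).recommend x : Vec d) ∈ B.epsOptimal ε μ o \ B.greedyAnswers μ}) ∪
      ⋃ z ∈ B.answers, ⋃ l ∈ t z, {x | ((s δ).stopTime x ≤ n ∧
      ((s δ).recommend x : Vec d) = z) ∧ (s δ).energy (l - μ) n x / 2 ≤ n * c}) ?_).trans ?_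
  · intro x hx
    have hfin : (s δ).stopTime x < ⊤ := lt_of_le_of_lt hx (WithTop.coe_lt_top n)
    by_cases h1 : ((s δ).recommend x : Vec d) ∈ B.epsOptimal ε μ o
    · by_cases h2 : ((s δ).recommend x : Vec d) ∈ B.greedyAnswers μ
      · right
        obtain ⟨l, hl, hle⟩ := (s δ).exists_energy_le (hcov _ h2) hn x
        exact Set.mem_iUnion₂.2 ⟨_, ((s δ).recommend x).2, Set.mem_iUnion₂.2
          ⟨l, hl, ⟨hx, rfl⟩, hle⟩⟩
      · exact Or.inl (Or.inr ⟨hfin, h1, h2⟩)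
    · exact Or.inl (Or.inl ⟨hfin, h1⟩)
  · refine (measure_union_le _ _).trans (add_le_add (measure_union_le _ _) ?_)
    refine (measure_biUnion_finset_le _ _).trans (Finset.sum_le_sum fun z _ => ?_)
    exact measure_biUnion_finset_le _ _

/-! ### From probabilities to expected sample complexity. -/

/-- Markov's inequality for an integer-valued time: `τ > n` means `τ ≥ n + 1`, so taking `n` to be
the floor of `r` loses nothing. -/
lemma Strategy.mul_one_sub_le_expectedTime (s : B.Strategy) (μ : Vec d) {r : ℝ} (n : ℕ)
    (hn : r ≤ n + 1) :
    ENNReal.ofReal r * (1 - s.law μ {x | s.stopTime x ≤ n}) ≤ s.expectedTime μ := by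
  have hm : MeasurableSet {x | s.stopTime x ≤ n} := history.le n _ (s.isStoppingTime n)
  rw [← prob_compl_eq_one_sub hm, ← lintegral_indicator_const hm.compl]
  refine lintegral_mono fun x => ?_
  by_cases hx : s.stopTime x ≤ n
  · rw [Set.indicator_of_notMem (show x ∉ {x | s.stopTime x ≤ n}ᶜ from fun h => h hx)]
    exact zero_le
  · rw [Set.indicator_of_mem (show x ∈ {x | s.stopTime x ≤ n}ᶜ from hx)]
    have h1 : ((n + 1 : ℕ) : ℕ∞) ≤ s.stopTime x := by
      push_cast
      exact Order.add_one_le_of_lt (not_le.1 hx)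
    calc ENNReal.ofReal r ≤ ENNReal.ofReal ((n + 1 : ℕ) : ℝ) :=
          ENNReal.ofReal_le_ofReal (by push_cast; exact hn)
      _ = (((n + 1 : ℕ) : ℕ∞) : ℝ≥0∞) := by rw [ENNReal.ofReal_natCast]; simp
      _ ≤ (s.stopTime x : ℝ≥0∞) := ENat.toENNReal_le.2 h1

theorem greedyCharTime_le_asymptoticComplexity {ε : ℝ} {o : Optimality} {s : ℝ → B.Strategy}
    (hs : B.IsPACFamily ε o s) (hg : B.IsAsymptoticallyGreedy ε o s) {μ : Vec d}
    (hμ : μ ∈ B.params) : B.greedyCharTime ε o μ ≤ B.asymptoticComplexity s μ := by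
  refine ENNReal.le_of_forall_nnreal_lt fun A hAT => ?_
  rcases eq_or_lt_of_le (zero_le (a := A)) with rfl | hA
  · simp
  -- The intermediate `A'` provides both strict inequalities: game values below `1 / A'`, and `A *
  -- (1 / A') < 1`.
  obtain ⟨A', hAA', hA'T⟩ := ENNReal.lt_iff_exists_nnreal_btwn.1 hAT
  have hAA' : A < A' := ENNReal.coe_lt_coe.1 hAA'
  have hA'pos : 0 < A' := hA.trans hAA'
  have hgame : ∀ z ∈ B.greedyAnswers μ, ∀ w ∈ stdSimplex ℝ B.arms,
      B.gameValue ε o μ z w < ENNReal.ofReal ((A' : ℝ)⁻¹) := by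
    intro z hz w hw
    rw [greedyCharTime, ENNReal.lt_inv_iff_lt_inv] at hA'T
    rw [ENNReal.ofReal_inv_of_pos (NNReal.coe_pos.2 hA'pos), ENNReal.ofReal_coe_nnreal]
    refine lt_of_le_of_lt ?_ hA'T
    exact (le_iSup₂ (f := fun w' _ => B.gameValue ε o μ z w') w hw).trans
      (le_iSup₂ (f := fun z' _ => ⨆ w' ∈ stdSimplex ℝ B.arms, B.gameValue ε o μ z' w') z hz)
  have hlt : (A : ℝ) * (A' : ℝ)⁻¹ < 1 := by
    rw [← div_eq_mul_inv, div_lt_one (NNReal.coe_pos.2 hA'pos)]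
    exact NNReal.coe_lt_coe.2 hAA'
  have hearly := tendsto_law_stopTime_le hs hg hμ (NNReal.coe_pos.2 hA)
    (inv_nonneg.2 A'.coe_nonneg) hlt hgame
  have hlow : Tendsto (fun δ => (A : ℝ≥0∞) *
      (1 - (s δ).law μ {x | (s δ).stopTime x ≤ ⌊(A : ℝ) * Real.log (1 / δ)⌋₊}))
      (𝓝[>] 0) (𝓝 A) := by
    have := ENNReal.Tendsto.const_mul (a := (A : ℝ≥0∞))
      (ENNReal.Tendsto.sub (tendsto_const_nhds (x := (1 : ℝ≥0∞))) hearly (Or.inl ENNReal.one_ne_top))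
      (Or.inr ENNReal.coe_ne_top)
    simpa using this
  rw [← hlow.liminf_eq, asymptoticComplexity]
  refine liminf_le_liminf ?_
  filter_upwards [tendsto_log_one_div.eventually_gt_atTop 0] with δ hδ
  rw [ENNReal.le_div_iff_mul_le (Or.inl (ENNReal.ofReal_pos.2 hδ).ne') (Or.inl ENNReal.ofReal_ne_top),
    mul_right_comm]
  refine le_trans (le_of_eq ?_) ((s δ).mul_one_sub_le_expectedTime μ
    ⌊(A : ℝ) * Real.log (1 / δ)⌋₊ (Nat.lt_floor_add_one _).le)
  rw [ENNReal.ofReal_mul A.coe_nonneg, ENNReal.ofReal_coe_nnreal]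

end Problem

end EpsBAI

end

theorem lemma1 {d : ℕ} (B : EpsBAI.Problem d) (o : EpsBAI.Optimality) (ε : ℝ) (hε : 0 ≤ ε)
    (hB : B.Admissible o) :
    (∀ s : ℝ → B.Strategy, B.IsPACFamily ε o s → B.IsAsymptoticallyGreedy ε o s →
      ∀ μ ∈ B.params, B.greedyCharTime ε o μ ≤ B.asymptoticComplexity s μ) ∧
    (∀ μ ∈ B.params, ∀ zF : EpsBAI.Vec d, B.furthestAnswers ε o μ = {zF} →
      (B.charTime ε o μ < B.greedyCharTime ε o μ ↔ zF ∉ B.greedyAnswers μ)) ∧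
    (∀ s : ℝ → B.Strategy, B.IsPACFamily ε o s → B.IsAsymptoticallyGreedy ε o s →
      ∀ μ ∈ B.params, ∀ zF : EpsBAI.Vec d, B.furthestAnswers ε o μ = {zF} →
        zF ∉ B.greedyAnswers μ → B.charTime ε o μ < B.asymptoticComplexity s μ) := by
  have h1 : ∀ s : ℝ → B.Strategy, B.IsPACFamily ε o s → B.IsAsymptoticallyGreedy ε o s →
      ∀ μ ∈ B.params, B.greedyCharTime ε o μ ≤ B.asymptoticComplexity s μ :=
    fun s hs hg μ hμ => EpsBAI.Problem.greedyCharTime_le_asymptoticComplexity hs hg hμ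
  have h2 : ∀ μ ∈ B.params, ∀ zF : EpsBAI.Vec d, B.furthestAnswers ε o μ = {zF} →
      (B.charTime ε o μ < B.greedyCharTime ε o μ ↔ zF ∉ B.greedyAnswers μ) :=
    fun μ hμ zF hF => EpsBAI.Problem.charTime_lt_greedyCharTime_iff hε hB hμ hF
  exact ⟨h1, h2, fun s hs hg μ hμ zF hF hz =>
    ((h2 μ hμ zF hF).2 hz).trans_le (h1 s hs hg μ hμ)⟩
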